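/- A \emph{$G$-function} is a formal power series $f(z)=\sum_{n\ge 0} a_n z^n$ whose coefficients $a_n$ are algebraic numbers in $\mathbb{C}$ and for which there is $C>0$ such that: (i) all conjugates of $a_n$ have modulus at most $C^{n+1}$ for every $n\ge 0$; (ii) there are nonzero integers $d_n$ with $|d_n|\le C^{n+1}$ such that $d_n a_m$ is an algebraic integer for all $m\le n$; (iii) $f$ satisfies a nontrivial homogeneous linear differential equation with coefficients in $\overline{\mathbb{Q}}(z)$. For a subfield $\mathbb{K}$ of $\mathbb{C}$ algebraic over $\mathbb{Q}$, let $\mathbf{G}_{\mathbb{K}}$ be the set of all $\xi\in\mathbb{C}$ such that for every real $R\ge 1$ there is a $G$-function $f$ with all Taylor coefficients at $0$ in $\mathbb{K}$ and radius of convergence $>R$ such that $\xi=f(1)$. \textbf{Lemma.} Let $\alpha\in\mathbb{C}$ be a nonzero algebraic number. For any determination of the logarithm, the number $\log(\alpha)$ belongs to $\mathbf{G}_{\mathbb{Q}(i)}$; that is, every $\xi\in\mathbb{C}$ with $e^{\xi}=\alpha$ belongs to $\mathbf{G}_{\mathbb{Q}(i)}$. -/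

import Mathlib

/-- A formal power series `f = ∑ aₙ zⁿ` with complex coefficients is a *G-function* (in the sense
of Siegel) if its coefficients are algebraic numbers, the moduli of all the conjugates of `aₙ`
and suitable common denominators `dₙ` of `a₀, …, aₙ` grow at most geometrically, and `f`
satisfies a nontrivial homogeneous linear differential equation over the field of rational
functions with algebraic coefficients (written here after clearing denominators). -/
structure IsGFunction (f : PowerSeries ℂ) : Prop where
  algebraic_coeff : ∀ n : ℕ, IsAlgebraic ℚ (PowerSeries.coeff n f)
  growth : ∃ C : ℝ, 0 < C ∧
    (∀ n : ℕ, ∀ β : ℂ, IsConjRoot ℚ (PowerSeries.coeff n f) β → ‖β‖ ≤ C ^ (n + 1)) ∧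
    (∃ d : ℕ → ℤ, ∀ n : ℕ, d n ≠ 0 ∧ |(d n : ℝ)| ≤ C ^ (n + 1) ∧
      ∀ m : ℕ, m ≤ n → IsIntegral ℤ ((d n : ℂ) * PowerSeries.coeff m f))
  differential_equation : ∃ (r : ℕ) (p : ℕ → Polynomial ℂ),
    (∀ j k : ℕ, IsAlgebraic ℚ ((p j).coeff k)) ∧ p r ≠ 0 ∧
    ∑ j ∈ Finset.range (r + 1),
      (p j : PowerSeries ℂ) * (PowerSeries.derivative ℂ)^[j] f = 0

/-- The radius of convergence at the origin of a power series with complex coefficients. -/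
noncomputable def cvRadius (f : PowerSeries ℂ) : ENNReal :=
  (FormalMultilinearSeries.ofScalars ℂ (fun n : ℕ => PowerSeries.coeff n f)).radius

/-- The set of all `ξ ∈ ℂ` such that `ξ = f(1)` for some G-function `f` with coefficients in `K`
and radius of convergence `> R`. -/
def GValuesRadius (K : IntermediateField ℚ ℂ) (R : ℝ) : Set ℂ :=
  {ξ : ℂ | ∃ f : PowerSeries ℂ, IsGFunction f ∧ (∀ n : ℕ, PowerSeries.coeff n f ∈ K) ∧
    ENNReal.ofReal R < cvRadius f ∧ HasSum (fun n : ℕ => PowerSeries.coeff n f) ξ}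

/-- The set of all `ξ ∈ ℂ` such that, for every real `R ≥ 1`, `ξ = f(1)` for some G-function `f`
(which may depend on `R`) with coefficients in `K` and radius of convergence `> R`. -/
def GValues (K : IntermediateField ℚ ℂ) : Set ℂ :=
  {ξ : ℂ | ∀ R : ℝ, 1 ≤ R → ξ ∈ GValuesRadius K R}

/-! Write `ξ = N log β` with `β = exp (ξ / N)`, which is algebraic and, for large `N`, close to `1`;
the principal logarithm then gives `ξ / N`, so all determinations are treated alike. Let `Q` be the
minimal polynomial of `β` and take `u ∈ ℚ(i)` close to `β`. The branch `φ` of `Q(φ(z)) = (1 - z)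
Q(u)` with `φ(0) = u` satisfies `φ(1) = β` and is analytic on a disc as large as desired, since
`Q(u)` is small (`exists_branch`). Set `g = u⁻¹ φ(z) (1 + (u - 1) z)` and `f = N log g`. Then `g(0)
= 1` and `g(1) = β`, hence `f(0) = 0` and `f(1) = ξ`, and no constant `log u` spoils the
coefficients.

It remains to see that `f` is a G-function over `ℚ(i)`. Since `u` is a simple root of `Q(T) - Q(u)`,
an Eisenstein-type argument shows that `φ` has coefficients in `ℚ(i)` with geometric denominators
(`exists_rescale_coeff_mem_integersIn`). Integrating `N g' / g` costs only `lcm(1, …, n)`, which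
Chebyshev bounds geometrically. Conjugation over `ℚ` preserves moduli in `ℚ(i)`. Finally, all
derivatives of `f` lie, up to powers of one denominator, in a finite `K[z]`-module, which forces a
linear differential equation. -/

/-! ### Integrality of algebraic power series -/

open PowerSeries in
theorem PowerSeries.coeff_pow_mem {A : Subring ℂ} {W : PowerSeries ℂ} {m : ℕ}
    (hW : ∀ j ≤ m, coeff j W ∈ A) (e : ℕ) : ∀ j ≤ m, coeff j (W ^ e) ∈ A := by
  induction e with
  | zero =>
    intro j _
    rw [pow_zero, coeff_one]
    split_ifs
    exacts [A.one_mem, A.zero_mem]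
  | succ e ih =>
    intro j hj
    rw [pow_succ, coeff_mul]
    refine A.sum_mem fun p hp => ?_
    have := Finset.HasAntidiagonal.mem_antidiagonal.1 hp
    exact A.mul_mem (ih _ (by omega)) (hW _ (by omega))

open PowerSeries in
/-- A power series without constant term that solves `Y = c X + ∑ bₖ Yᵏ⁺²` with `c` and all `bₖ`
in a subring has all its coefficients in that subring. -/
theorem PowerSeries.coeff_mem_of_fixedPoint {A : Subring ℂ} {Y : PowerSeries ℂ}
    (h0 : constantCoeff Y = 0) {c : ℂ} (hc : c ∈ A) {b : ℕ → ℂ} (hb : ∀ k, b k ∈ A) {d : ℕ}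
    (hY : Y = C c * X + ∑ k ∈ Finset.range d, C (b k) * Y ^ (k + 2)) (n : ℕ) :
    coeff n Y ∈ A := by
  obtain ⟨W, hW⟩ := X_dvd_iff.2 h0
  induction n using Nat.strong_induction_on with
  | _ n ih =>
    rw [hY, map_add, map_sum]
    refine A.add_mem ?_ (A.sum_mem fun k _ => ?_)
    · rw [coeff_C_mul, coeff_X]
      split_ifs
      · simpa using hc
      · simp
    -- With `Y = X W` and exponent at least 2, the `n`-th coefficient of `Y ^ (k + 2)` involves only
    -- coefficients of `Y` of index below `n`.
    · rw [coeff_C_mul, hW, mul_pow, coeff_X_pow_mul']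
      refine A.mul_mem (hb k) ?_
      split_ifs with h
      · refine coeff_pow_mem (m := n - (k + 2)) (fun j hj => ?_) _ _ le_rfl
        have := ih (j + 1) (by omega)
        rwa [hW, coeff_succ_X_mul] at this
      · exact A.zero_mem

/-- The ring of algebraic integers in a subfield of `ℂ`. -/
noncomputable def integersIn (K : IntermediateField ℚ ℂ) : Subring ℂ :=
  (integralClosure ℤ ℂ).toSubring ⊓ K.toSubfield.toSubring

theorem exists_natCast_mul_isIntegral {x : ℂ} (hx : IsAlgebraic ℚ x) :
    ∃ D : ℕ, D ≠ 0 ∧ IsIntegral ℤ ((D : ℂ) * x) := by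
  have hx' : IsAlgebraic ℤ x := (IsFractionRing.isAlgebraic_iff ℤ ℚ ℂ).2 hx
  obtain ⟨d, hd, h⟩ := hx'.exists_integral_multiple
  refine ⟨d.natAbs, Int.natAbs_ne_zero.2 hd, ?_⟩
  have h1 : IsIntegral ℤ ((d : ℂ) * x) := by simpa using h
  rcases Int.natAbs_eq d with h2 | h2
  · have : ((d.natAbs : ℕ) : ℂ) = (d : ℂ) := by
      conv_rhs => rw [h2]
      simp
    rwa [this]
  · have : ((d.natAbs : ℕ) : ℂ) = -(d : ℂ) := by
      conv_rhs => rw [h2]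
      simp
    rw [this, neg_mul]
    exact h1.neg

theorem exists_natCast_mul_mem_integersIn {K : IntermediateField ℚ ℂ}
    (hK : ∀ x ∈ K, IsAlgebraic ℚ x) {x : ℂ} (hx : x ∈ K) :
    ∃ D : ℕ, D ≠ 0 ∧ (D : ℂ) * x ∈ integersIn K := by
  obtain ⟨D, hD, h⟩ := exists_natCast_mul_isIntegral (hK x hx)
  exact ⟨D, hD, h, K.mul_mem (natCast_mem K D) hx⟩

theorem exists_natCast_mul_mem_integersIn_of_finite {K : IntermediateField ℚ ℂ}
    (hK : ∀ x ∈ K, IsAlgebraic ℚ x) {x : ℕ → ℂ} (hx : ∀ k, x k ∈ K) {n : ℕ}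
    (hn : ∀ k, n ≤ k → x k = 0) :
    ∃ D : ℕ, D ≠ 0 ∧ ∀ k, (D : ℂ) * x k ∈ integersIn K := by
  choose d hd h using fun k => exists_natCast_mul_mem_integersIn hK (hx k)
  refine ⟨∏ k ∈ Finset.range n, d k, Finset.prod_ne_zero_iff.2 fun k _ => hd k, fun k => ?_⟩
  by_cases hk : k < n
  · rw [← Finset.mul_prod_erase _ _ (Finset.mem_range.2 hk), Nat.cast_mul, mul_right_comm, mul_comm]
    exact (integersIn K).mul_mem (natCast_mem _ _) (h k)
  · rw [hn k (not_lt.1 hk), mul_zero]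
    exact (integersIn K).zero_mem

open PowerSeries in
theorem PowerSeries.rescale_C (a b : ℂ) : rescale a (C b) = C b := by
  ext n
  rw [coeff_rescale, coeff_C]
  split_ifs with h <;> simp [h]

open PowerSeries in
/-- A form of Eisenstein's theorem on the denominators of the coefficients of an algebraic
power series. -/
theorem exists_rescale_coeff_mem_integersIn {K : IntermediateField ℚ ℂ}
    (hK : ∀ x ∈ K, IsAlgebraic ℚ x) {P : Polynomial ℂ} (hP : ∀ k, P.coeff k ∈ K)
    (hP1 : P.coeff 1 ≠ 0) {Y : PowerSeries ℂ} (h0 : constantCoeff Y = 0)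
    (hY : Polynomial.aeval Y P = (1 - X) * C (P.coeff 0)) :
    ∃ D : ℕ, D ≠ 0 ∧ ∀ n, coeff n (rescale (D : ℂ) Y) ∈ integersIn K := by
  obtain ⟨D, hD, hDP⟩ := exists_natCast_mul_mem_integersIn_of_finite hK
    (x := fun k => P.coeff k / P.coeff 1) (fun k => K.div_mem (hP k) (hP 1)) (n := P.natDegree + 1)
    (fun k hk => by
      show P.coeff k / P.coeff 1 = 0
      rw [Polynomial.coeff_eq_zero_of_natDegree_lt (by omega), zero_div])
  have hDC : (D : ℂ) ≠ 0 := Nat.cast_ne_zero.2 hD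
  -- Substituting `Y(D² X) = D Z` and dividing by `D` times the linear coefficient leaves at least
  -- one factor `D` on every ratio `P.coeff k / P.coeff 1`, exactly enough to make it integral.
  have key : ∀ n, coeff n (C (D : ℂ)⁻¹ * rescale ((D : ℂ) ^ 2) Y) ∈ integersIn K := by
    set Z := C (D : ℂ)⁻¹ * rescale ((D : ℂ) ^ 2) Y with hZ
    have hZY : rescale ((D : ℂ) ^ 2) Y = C (D : ℂ) * Z := by
      rw [hZ, ← mul_assoc, ← map_mul, mul_inv_cancel₀ hDC, map_one, one_mul]
    have hZ0 : constantCoeff Z = 0 := by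
      rw [hZ, map_mul, ← coeff_zero_eq_constantCoeff_apply (rescale _ Y), coeff_rescale,
        coeff_zero_eq_constantCoeff_apply, h0, mul_zero, mul_zero]
    refine coeff_mem_of_fixedPoint hZ0 (c := -((D : ℂ) * (P.coeff 0 / P.coeff 1)))
      (neg_mem (hDP 0))
      (b := fun k => -((D : ℂ) * (P.coeff (k + 2) / P.coeff 1) * (D : ℂ) ^ k))
      (fun k => neg_mem (mul_mem (hDP _) (pow_mem (natCast_mem _ _) _))) (d := P.natDegree) ?_
    have e := congrArg (rescale ((D : ℂ) ^ 2)) hY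
    rw [Polynomial.aeval_eq_sum_range' (n := P.natDegree + 2) (by omega), Finset.sum_range_succ',
      Finset.sum_range_succ'] at e
    simp only [smul_eq_C_mul, map_add, map_sum, map_mul, map_pow, map_sub, map_one, hZY, rescale_X,
      rescale_C, pow_zero, mul_one, zero_add, pow_one] at e
    have hu : C (P.coeff 1) * C (P.coeff 1)⁻¹ = (1 : PowerSeries ℂ) := by
      rw [← map_mul, mul_inv_cancel₀ hP1, map_one]
    have hu' : C (D : ℂ) * C (D : ℂ)⁻¹ = (1 : PowerSeries ℂ) := by
      rw [← map_mul, mul_inv_cancel₀ hDC, map_one]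
    have e2 : ∑ k ∈ Finset.range P.natDegree,
        C (-((D : ℂ) * (P.coeff (k + 2) / P.coeff 1) * (D : ℂ) ^ k)) * Z ^ (k + 2)
        = -(C (P.coeff 1)⁻¹ * C (D : ℂ)⁻¹) * ∑ k ∈ Finset.range P.natDegree,
          C (P.coeff (k + 1 + 1)) * (C (D : ℂ) * Z) ^ (k + 1 + 1) := by
      rw [Finset.mul_sum]
      refine Finset.sum_congr rfl fun k _ => ?_
      simp only [div_eq_mul_inv, map_neg, map_mul, map_pow]
      linear_combination (-C (P.coeff (k + 2)) * C (P.coeff 1)⁻¹ * C (D : ℂ) ^ (k + 1)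
        * Z ^ (k + 2)) * -hu'
    rw [e2]
    simp only [div_eq_mul_inv, map_neg, map_mul]
    generalize (∑ k ∈ Finset.range P.natDegree,
          C (P.coeff (k + 1 + 1)) * (C (D : ℂ) * Z) ^ (k + 1 + 1)) = S at e ⊢
    linear_combination (C (P.coeff 1)⁻¹ * C (D : ℂ)⁻¹) * e - Z * hu
      - Z * (C (P.coeff 1) * C (P.coeff 1)⁻¹) * hu'
      - C (D : ℂ) * X * C (P.coeff 0) * C (P.coeff 1)⁻¹ * hu'
  refine ⟨D ^ 2, pow_ne_zero _ hD, fun n => ?_⟩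
  have : coeff n (rescale ((D ^ 2 : ℕ) : ℂ) Y)
      = (D : ℂ) * coeff n (C (D : ℂ)⁻¹ * rescale ((D : ℂ) ^ 2) Y) := by
    rw [coeff_C_mul, ← mul_assoc, mul_inv_cancel₀ hDC, one_mul, Nat.cast_pow]
  rw [this]
  exact mul_mem (natCast_mem _ _) (key n)

/-! ### Denominators of logarithms -/

-- Constant term `1` makes `G` invertible already over `A`, so the quotient `H / G` stays over `A`.
open PowerSeries in
theorem PowerSeries.coeff_mem_of_mul_eq {A : Subring ℂ} {G H B : PowerSeries ℂ}
    (hG : ∀ n, coeff n G ∈ A) (hH : ∀ n, coeff n H ∈ A) (hG1 : constantCoeff G = 1)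
    (h : B * G = H) (n : ℕ) : coeff n B ∈ A := by
  set γ : PowerSeries A := mk fun n => ⟨coeff n G, hG n⟩ with hγ
  set η : PowerSeries A := mk fun n => ⟨coeff n H, hH n⟩ with hη
  have eγ : map A.subtype γ = G := by ext n; simp [hγ]
  have eη : map A.subtype η = H := by ext n; simp [hη]
  have hu : IsUnit γ := by
    rw [isUnit_iff_constantCoeff]
    have : constantCoeff γ = 1 := by
      apply Subtype.ext
      simp [hγ, hG1, ← coeff_zero_eq_constantCoeff_apply]
    rw [this]; exact isUnit_one
  obtain ⟨δ, hδ⟩ := hu.exists_right_inv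
  have : B = map A.subtype (η * δ) := by
    rw [map_mul, eη, ← h, mul_assoc, ← eγ, ← map_mul, hδ, map_one, mul_one]
  rw [this, coeff_map]
  exact Subtype.prop _

open PowerSeries in
theorem PowerSeries.derivative_rescale (a : ℂ) (f : PowerSeries ℂ) :
    derivative ℂ (rescale a f) = C a * rescale a (derivative ℂ f) := by
  ext n
  rw [coeff_derivative, coeff_rescale, coeff_C_mul, coeff_rescale, coeff_derivative]
  ring

/-- Chebyshev's bound `ψ(n) ≤ (log 4 + 4) n`, exponentiated. -/
theorem natCast_lcmUpto_le (n : ℕ) : (Nat.lcmUpto n : ℝ) ≤ Real.exp (Real.log 4 + 4) ^ n := by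
  have h := Chebyshev.psi_le_const_mul_self (Nat.cast_nonneg (α := ℝ) n)
  rw [Chebyshev.psi_eq_log_lcmUpto, Real.log_le_iff_le_exp (by exact_mod_cast Nat.lcmUpto_pos n)] at h
  rwa [← Real.exp_nat_mul, mul_comm]

open PowerSeries in
/-- Denominators of `N log Γ`, for a power series `Γ` with constant term `1` whose denominators
grow geometrically. -/
theorem exists_denominators_of_logarithmic {A : Subring ℂ} {F G : PowerSeries ℂ} {N D : ℕ}
    (hF0 : constantCoeff F = 0) (hG1 : constantCoeff G = 1)
    (hF : derivative ℂ F * G = C (N : ℂ) * derivative ℂ G)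
    (hD : ∀ n, coeff n (rescale (D : ℂ) G) ∈ A) (m n : ℕ) (hmn : m ≤ n) :
    ((D ^ n * Nat.lcmUpto n : ℕ) : ℂ) * coeff m F ∈ A := by
  have h : derivative ℂ (rescale (D : ℂ) F) * rescale (D : ℂ) G
      = C (N : ℂ) * derivative ℂ (rescale (D : ℂ) G) := by
    rw [derivative_rescale, derivative_rescale, mul_assoc, ← map_mul, hF, map_mul, rescale_C]
    ring
  -- This is the logarithmic derivative after rescaling; its coefficient of index `m` is `D ^ (m +
  -- 1) (m + 1)` times that of `F` of index `m + 1`, so only the factor `m + 1` remains to be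
  -- cleared by the lcm.
  have hmem := coeff_mem_of_mul_eq hD (fun n => by
    rw [coeff_C_mul, coeff_derivative]
    exact mul_mem (natCast_mem _ _) (mul_mem (hD _) (by exact_mod_cast natCast_mem A (n + 1))))
    (by rw [← coeff_zero_eq_constantCoeff_apply, coeff_rescale, coeff_zero_eq_constantCoeff_apply,
      hG1, pow_zero, one_mul]) h
  rcases m with _ | m
  · rw [coeff_zero_eq_constantCoeff_apply, hF0, mul_zero]; exact A.zero_mem
  · have h1 := hmem m
    rw [coeff_derivative, coeff_rescale] at h1
    have h2 : m + 1 ∣ Nat.lcmUpto n := Finset.dvd_lcm (Finset.mem_Icc.2 ⟨by omega, hmn⟩)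
    obtain ⟨c, hc⟩ := h2
    obtain ⟨e, rfl⟩ := Nat.exists_eq_add_of_le hmn
    have : ((D ^ (m + 1 + e) * Nat.lcmUpto (m + 1 + e) : ℕ) : ℂ) * coeff (m + 1) F
        = ((c * D ^ e : ℕ) : ℂ) * ((D : ℂ) ^ (m + 1) * coeff (m + 1) F * ((m : ℂ) + 1)) := by
      rw [hc]; push_cast; ring
    rw [this]
    exact mul_mem (natCast_mem _ _) h1

/-! ### Conjugates in `ℚ(i)` -/

theorem exists_ratCast_add_mul_I_of_mem_adjoin {a : ℂ}
    (ha : a ∈ IntermediateField.adjoin ℚ {Complex.I}) : ∃ x y : ℚ, a = x + y * Complex.I := by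
  induction ha using IntermediateField.adjoin_induction with
  | mem x hx => exact ⟨0, 1, by simpa using hx⟩
  | algebraMap q => exact ⟨q, 0, by simp⟩
  | add a b _ _ ha hb =>
    obtain ⟨x, y, rfl⟩ := ha
    obtain ⟨x', y', rfl⟩ := hb
    exact ⟨x + x', y + y', by push_cast; ring⟩
  | inv a _ ha =>
    obtain ⟨x, y, rfl⟩ := ha
    refine ⟨x / (x ^ 2 + y ^ 2), -y / (x ^ 2 + y ^ 2), ?_⟩
    by_cases h : x ^ 2 + y ^ 2 = 0
    · have hx : x = 0 := by nlinarith [sq_nonneg x, sq_nonneg y]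
      have hy : y = 0 := by nlinarith [sq_nonneg x, sq_nonneg y]
      simp [hx, hy]
    · have hC : ((x : ℂ) ^ 2 + (y : ℂ) ^ 2) ≠ 0 := by exact_mod_cast h
      have hm : ((x : ℂ) + y * Complex.I) * (x - y * Complex.I) = (x : ℂ) ^ 2 + (y : ℂ) ^ 2 := by
        linear_combination (-(y : ℂ) ^ 2) * Complex.I_sq
      refine inv_eq_of_mul_eq_one_right ?_
      push_cast
      rw [← div_self hC, ← hm]
      ring
  | mul a b _ _ ha hb =>
    obtain ⟨x, y, rfl⟩ := ha
    obtain ⟨x', y', rfl⟩ := hb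
    refine ⟨x * x' - y * y', x * y' + y * x', ?_⟩
    push_cast
    linear_combination ((y : ℂ) * y') * Complex.I_sq

/-- The polynomial `(T - x)² + y²` kills `x + iy`, so a conjugate is either the number itself or its
complex conjugate. -/
theorem norm_eq_of_isConjRoot_of_mem_adjoin_I {a b : ℂ}
    (ha : a ∈ IntermediateField.adjoin ℚ {Complex.I}) (h : IsConjRoot ℚ a b) : ‖b‖ = ‖a‖ := by
  obtain ⟨x, y, rfl⟩ := exists_ratCast_add_mul_I_of_mem_adjoin ha
  have hdvd : minpoly ℚ ((x : ℂ) + y * Complex.I) ∣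
      (Polynomial.X - Polynomial.C x) ^ 2 + Polynomial.C (y ^ 2) := by
    refine minpoly.dvd _ _ ?_
    simp only [map_add, map_pow, map_sub, Polynomial.aeval_X, Polynomial.aeval_C, eq_ratCast]
    linear_combination ((y : ℂ) ^ 2) * Complex.I_sq
  have hb : ((b - x) ^ 2 + (y : ℂ) ^ 2) = 0 := by
    have := Polynomial.aeval_eq_zero_of_dvd_aeval_eq_zero hdvd h.aeval_eq_zero
    simpa using this
  have hb' : (b - (x + y * Complex.I)) * (b - (x - y * Complex.I)) = 0 := by
    linear_combination hb - ((y : ℂ) ^ 2) * Complex.I_sq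
  rcases mul_eq_zero.1 hb' with h1 | h1
  · rw [sub_eq_zero.1 h1]
  · rw [sub_eq_zero.1 h1, ← Complex.norm_conj ((x : ℂ) + _)]
    congr 1
    simp [sub_eq_add_neg]

theorem isAlgebraic_of_mem_adjoin_I {a : ℂ}
    (ha : a ∈ IntermediateField.adjoin ℚ {Complex.I}) : IsAlgebraic ℚ a := by
  have hI : IsIntegral ℚ Complex.I :=
    ⟨Polynomial.X ^ 2 + 1, by monicity!, by simp⟩
  have := IntermediateField.isAlgebraic_adjoin (K := ℚ) (L := ℂ) (S := {Complex.I})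
    (by rintro x rfl; exact hI)
  exact (this.isAlgebraic ⟨a, ha⟩).algebraMap (A := ℂ)

/-! ### Differential equations from finite modules -/

open PowerSeries in
theorem PowerSeries.algebraMap_polynomial_eq_coe (K : IntermediateField ℚ ℂ) (p : Polynomial K) :
    algebraMap (Polynomial K) (PowerSeries ℂ) p = ((p.map (algebraMap K ℂ) : Polynomial ℂ) :
      PowerSeries ℂ) := by
  ext n
  rw [algebraMap_apply']
  simp

theorem Module.exists_nontrivial_relation_of_finite {R M : Type*} [CommRing R] [Nontrivial R]
    [AddCommGroup M] [Module R M] [Module.Finite R M] (v : ℕ → M) :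
    ∃ n ≤ Module.finrank R M, ∃ g : ℕ → R,
      g n ≠ 0 ∧ ∑ j ∈ Finset.range (n + 1), g j • v j = 0 := by
  classical
  set d := Module.finrank R M
  have hv : ¬ LinearIndependent R (fun i : Fin (d + 1) => v i) := fun h => by
    have := h.fintype_card_le_finrank
    rw [Fintype.card_fin] at this
    omega
  obtain ⟨g, hg, i, hi⟩ := Fintype.not_linearIndependent_iff.1 hv
  set g' : ℕ → R := fun j => if h : j < d + 1 then g ⟨j, h⟩ else 0 with hg'
  have hi' : g' i ≠ 0 := by
    simpa only [hg', dif_pos i.2] using hi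
  have hsum : ∑ j ∈ Finset.range (d + 1), g' j • v j = 0 := by
    rw [← hg, Finset.sum_range]
    exact Finset.sum_congr rfl fun j _ => by simp only [hg', dif_pos j.2]
  have hid : (i : ℕ) ≤ d := by omega
  -- Truncating at the last nonzero coefficient makes the leading coefficient nonzero.
  refine ⟨Nat.findGreatest (fun j => g' j ≠ 0) d, Nat.findGreatest_le _, g',
    Nat.findGreatest_spec (P := fun j => g' j ≠ 0) hid hi', ?_⟩
  rw [← hsum]
  refine Finset.sum_subset (Finset.range_subset_range.2 (by
    have := Nat.findGreatest_le (P := fun j => g' j ≠ 0) d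
    omega)) fun j hj hj' => ?_
  rw [Finset.mem_range] at hj hj'
  have := Nat.findGreatest_is_greatest (P := fun j => g' j ≠ 0) (n := d) (k := j)
    (by omega) (by omega)
  rw [not_not.1 this, zero_smul]

open PowerSeries in
/-- Iterated derivatives stay in a differentially stable algebra after multiplication by powers
of a denominator `s`. -/
theorem PowerSeries.pow_mul_iterate_derivative_mem {R : Type*} [CommRing R]
    [Algebra R (PowerSeries ℂ)] {B : Subalgebra R (PowerSeries ℂ)} {s F : PowerSeries ℂ}
    (hs : s ∈ B) (hB : ∀ b ∈ B, s * derivative ℂ b ∈ B) (hF : s * derivative ℂ F ∈ B) (n : ℕ) :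
    s ^ (2 * n + 1) * (derivative ℂ)^[n + 1] F ∈ B := by
  induction n with
  | zero => simpa using hF
  | succ n ih =>
    -- With `b = s ^ (2n+1) F⁽ⁿ⁺¹⁾`, one has `s · (s b') - (2n+1) (s s') b = s ^ (2n+3) F⁽ⁿ⁺²⁾`:
    -- each derivative costs two factors `s`.
    have h1 := B.mul_mem hs (hB _ ih)
    have h2 := B.mul_mem (B.mul_mem (B.natCast_mem (2 * n + 1)) (hB s hs)) ih
    have h3 := B.sub_mem h1 h2
    rw [Function.iterate_succ_apply']
    convert h3 using 1
    rw [Derivation.leibniz, Derivation.leibniz_pow]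
    simp only [smul_eq_mul, nsmul_eq_mul, Nat.add_sub_cancel]
    push_cast
    ring

-- A single power of `s` brings `F', …, F⁽ᵈ⁺¹⁾` into `B`, where `d` is its rank; these `d + 1`
-- elements are dependent over `K[X]`, and the power of `s` cancels.
open PowerSeries in
theorem exists_differential_equation_of_finite {K : IntermediateField ℚ ℂ}
    (hK : ∀ x ∈ K, IsAlgebraic ℚ x) {B : Subalgebra (Polynomial K) (PowerSeries ℂ)}
    [Module.Finite (Polynomial K) B] {s F : PowerSeries ℂ} (hs0 : s ≠ 0)
    (hs : s ∈ B) (hB : ∀ b ∈ B, s * derivative ℂ b ∈ B) (hF : s * derivative ℂ F ∈ B) :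
    ∃ (r : ℕ) (p : ℕ → Polynomial ℂ),
      (∀ j k : ℕ, IsAlgebraic ℚ ((p j).coeff k)) ∧ p r ≠ 0 ∧
      ∑ j ∈ Finset.range (r + 1),
        (p j : PowerSeries ℂ) * (derivative ℂ)^[j] F = 0 := by
  set d := Module.finrank (Polynomial K) B
  have hmem : ∀ j ≤ d, s ^ (2 * d + 1) * (derivative ℂ)^[j + 1] F ∈ B := fun j hj => by
    obtain ⟨e, he⟩ := Nat.exists_eq_add_of_le hj
    have := B.mul_mem (B.pow_mem hs (2 * e)) (pow_mul_iterate_derivative_mem hs hB hF j)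
    rwa [← mul_assoc, ← pow_add, show 2 * e + (2 * j + 1) = 2 * d + 1 by omega] at this
  obtain ⟨n, hn, g, hg, hsum⟩ := Module.exists_nontrivial_relation_of_finite
    (R := Polynomial K) (M := B)
    (fun j => if h : j ≤ d then ⟨s ^ (2 * d + 1) * (derivative ℂ)^[j + 1] F, hmem j h⟩ else 0)
  -- The relation starts at `F'`, so `F` itself gets coefficient `0`.
  refine ⟨n + 1, fun j => Nat.casesOn j 0 fun j => (g j).map (algebraMap K ℂ), fun j k => ?_, ?_, ?_⟩
  · rcases j with _ | j
    · simpa using isAlgebraic_zero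
    · simpa using hK _ ((g j).coeff k).2
  · exact (Polynomial.map_ne_zero_iff (algebraMap K ℂ).injective).2 hg
  · rw [Finset.sum_range_succ']
    refine (mul_eq_zero.1 ?_).resolve_left (pow_ne_zero (2 * d + 1) hs0)
    change _ * (_ + ((0 : Polynomial ℂ) : PowerSeries ℂ) * _) = 0
    rw [Polynomial.coe_zero, zero_mul, add_zero]
    rw [Finset.mul_sum, ← Subalgebra.coe_zero B, ← hsum, AddSubmonoidClass.coe_finsetSum]
    refine Finset.sum_congr rfl fun j hj => ?_
    have hj' : j ≤ d := by
      have := Finset.mem_range.1 hj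
      omega
    rw [dif_pos hj', Subalgebra.coe_smul, Algebra.smul_def, algebraMap_polynomial_eq_coe]
    ring

-- The algebra `K[X][Φ]` is finite over `K[X]`. Differentiating the equation of `Φ` gives `Q'(Φ) Φ'
-- = -Q(u)`, so `s = Φ Q'(Φ) (1 + (u - 1) X)` clears the denominators of both `Φ'` and `F'`.
open PowerSeries in
theorem exists_differential_equation_of_logarithmic {K : IntermediateField ℚ ℂ}
    (hK : ∀ x ∈ K, IsAlgebraic ℚ x) {Q : Polynomial K} (hQ : Q.Monic) {u : ℂ} (hu : u ∈ K)
    (hu0 : u ≠ 0) (hQu : Polynomial.aeval u (Polynomial.derivative Q) ≠ 0)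
    {Φ F : PowerSeries ℂ} {N : ℕ} (hΦ0 : constantCoeff Φ = u)
    (hΦ : Polynomial.aeval Φ (Q.map (algebraMap K ℂ)) = (1 - X) * C (Polynomial.aeval u Q))
    (hF : derivative ℂ F * (C u⁻¹ * Φ * (1 + C (u - 1) * X))
      = C (N : ℂ) * derivative ℂ (C u⁻¹ * Φ * (1 + C (u - 1) * X))) :
    ∃ (r : ℕ) (p : ℕ → Polynomial ℂ),
      (∀ j k : ℕ, IsAlgebraic ℚ ((p j).coeff k)) ∧ p r ≠ 0 ∧
      ∑ j ∈ Finset.range (r + 1),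
        (p j : PowerSeries ℂ) * (derivative ℂ)^[j] F = 0 := by
  have hpoly : ∀ (B : Subalgebra (Polynomial K) (PowerSeries ℂ)) (p : Polynomial K),
      ((p.map (algebraMap K ℂ) : Polynomial ℂ) : PowerSeries ℂ) ∈ B := fun B p => by
    rw [← algebraMap_polynomial_eq_coe]; exact B.algebraMap_mem p
  have hC : ∀ (B : Subalgebra (Polynomial K) (PowerSeries ℂ)) {c : ℂ}, c ∈ K → C c ∈ B :=
    fun B c hc => by simpa using hpoly B (Polynomial.C ⟨c, hc⟩)
  have hX : ∀ (B : Subalgebra (Polynomial K) (PowerSeries ℂ)), (X : PowerSeries ℂ) ∈ B :=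
    fun B => by simpa using hpoly B Polynomial.X
  have hqK : Polynomial.aeval u Q ∈ K := by
    have : Polynomial.aeval u Q = ((Polynomial.aeval (⟨u, hu⟩ : K) Q : K) : ℂ) := by
      rw [← IntermediateField.algebraMap_apply, ← Polynomial.aeval_algebraMap_apply]
      rfl
    rw [this]; exact Subtype.prop _
  set q := Polynomial.aeval u Q with hq
  have hdeg : 0 < Q.natDegree := by
    by_contra h
    rw [(hQ.natDegree_eq_zero).1 (by omega)] at hQu
    simp at hQu
  have haev : ∀ p : Polynomial K, Polynomial.aeval Φ (p.map Polynomial.C)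
      = Polynomial.aeval Φ (p.map (algebraMap K ℂ)) := fun p => by
    rw [Polynomial.aeval_def, Polynomial.aeval_def, Polynomial.eval₂_map, Polynomial.eval₂_map]
    congr 1
    ext1 x
    simp only [RingHom.comp_apply]
    rw [algebraMap_polynomial_eq_coe]
    simp
  have hint : IsIntegral (Polynomial K) Φ := by
    -- The monic equation is `Q(T) - (1 - X) Q(u)`; positive degree of `Q` keeps it monic.
    refine ⟨Q.map Polynomial.C - Polynomial.C ((1 - Polynomial.X) * Polynomial.C ⟨q, hqK⟩), ?_, ?_⟩
    · refine (hQ.map _).sub_of_left (Polynomial.degree_C_le.trans_lt ?_)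
      rw [hQ.degree_map]
      exact Polynomial.natDegree_pos_iff_degree_pos.1 hdeg
    · rw [← Polynomial.aeval_def, map_sub, haev, hΦ, Polynomial.aeval_C,
        algebraMap_polynomial_eq_coe]
      simp
  set B := Algebra.adjoin (Polynomial K) {Φ} with hBdef
  have : Module.Finite (Polynomial K) B := ⟨(Submodule.fg_top _).2 hint.fg_adjoin_singleton⟩
  have hΦB : Φ ∈ B := Algebra.self_mem_adjoin_singleton _ _
  set E := Polynomial.aeval Φ ((Polynomial.derivative Q).map (algebraMap K ℂ)) with hE
  have hEB : E ∈ B := by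
    rw [hE, ← haev]
    exact Polynomial.aeval_mem_adjoin_singleton _ _
  have hdΦ : E * derivative ℂ Φ = -C q := by
    have := congrArg (derivative ℂ) hΦ
    rw [Derivation.map_aeval, Polynomial.derivative_map] at this
    rw [← hE] at this
    simpa [Derivation.leibniz] using this
  set l : PowerSeries ℂ := 1 + C (u - 1) * X with hl
  have hlB : l ∈ B := B.add_mem B.one_mem (B.mul_mem (hC B (K.sub_mem hu K.one_mem)) (hX B))
  have hE0 : constantCoeff E ≠ 0 := by
    have : constantCoeff E = Polynomial.aeval u (Polynomial.derivative Q) := by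
      rw [hE, Polynomial.aeval_def, Polynomial.hom_eval₂, hΦ0, Polynomial.eval₂_map]
      rfl
    rwa [this]
  refine exists_differential_equation_of_finite hK (B := B) (s := Φ * E * l) (F := F) ?_ ?_ ?_ ?_
  · intro h
    have := congrArg constantCoeff h
    simp [hl, hΦ0, hu0, hE0] at this
  · exact B.mul_mem (B.mul_mem hΦB hEB) hlB
  · intro b hb
    induction hb using Algebra.adjoin_induction with
    | mem x hx =>
      rw [Set.mem_singleton_iff.1 hx]
      have : Φ * E * l * derivative ℂ Φ = - (Φ * l * C q) := by linear_combination (Φ * l) * hdΦ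
      rw [this]
      exact B.neg_mem (B.mul_mem (B.mul_mem hΦB hlB) (hC B hqK))
    | algebraMap r =>
      rw [algebraMap_polynomial_eq_coe, derivative_coe, Polynomial.derivative_map]
      exact B.mul_mem (B.mul_mem (B.mul_mem hΦB hEB) hlB) (hpoly B _)
    | add x y _ _ hx hy => rw [map_add, mul_add]; exact B.add_mem hx hy
    | mul x y hx' hy' hx hy =>
      have : Φ * E * l * derivative ℂ (x * y)
          = x * (Φ * E * l * derivative ℂ y) + y * (Φ * E * l * derivative ℂ x) := by
        rw [Derivation.leibniz]; simp only [smul_eq_mul]; ring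
      rw [this]
      exact B.add_mem (B.mul_mem hx' hy) (B.mul_mem hy' hx)
  · have hdl : derivative ℂ l = C (u - 1) := by
      simp [hl, Derivation.leibniz]
    have huC : C u * C u⁻¹ = (1 : PowerSeries ℂ) := by
      rw [← map_mul, mul_inv_cancel₀ hu0, map_one]
    have : Φ * E * l * derivative ℂ F = C (N : ℂ) * (Φ * E * C (u - 1) - l * C q) := by
      simp only [Derivation.leibniz, smul_eq_mul, hdl, derivative_C, mul_zero, add_zero] at hF
      have hF' : derivative ℂ F * (Φ * l) = C (N : ℂ) * (Φ * C (u - 1) + l * derivative ℂ Φ) := by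
        linear_combination C u * hF - (derivative ℂ F * (Φ * l)
          - C (N : ℂ) * (Φ * C (u - 1) + l * derivative ℂ Φ)) * huC
      linear_combination E * hF' + C (N : ℂ) * l * hdΦ
    rw [this]
    refine B.mul_mem (hC B (natCast_mem _ _)) (B.sub_mem (B.mul_mem (B.mul_mem hΦB hEB)
      (hC B (K.sub_mem hu K.one_mem))) (B.mul_mem hlB (hC B hqK)))

/-! ### Taylor series of analytic functions -/

/-- The formal Taylor series at the origin of a complex function. -/
noncomputable def taylorSeries (h : ℂ → ℂ) : PowerSeries ℂ :=
  PowerSeries.mk fun n => (n.factorial : ℂ)⁻¹ * iteratedDeriv n h 0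

theorem coeff_taylorSeries (h : ℂ → ℂ) (n : ℕ) :
    PowerSeries.coeff n (taylorSeries h) = (n.factorial : ℂ)⁻¹ * iteratedDeriv n h 0 :=
  PowerSeries.coeff_mk _ _

theorem constantCoeff_taylorSeries (h : ℂ → ℂ) :
    PowerSeries.constantCoeff (taylorSeries h) = h 0 := by
  rw [← PowerSeries.coeff_zero_eq_constantCoeff_apply, coeff_taylorSeries]
  simp

open Filter Topology in
theorem taylorSeries_congr {h k : ℂ → ℂ} (e : h =ᶠ[𝓝 0] k) : taylorSeries h = taylorSeries k := by
  ext n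
  rw [coeff_taylorSeries, coeff_taylorSeries, e.iteratedDeriv_eq]

theorem taylorSeries_const (c : ℂ) : taylorSeries (fun _ => c) = PowerSeries.C c := by
  ext n
  rw [coeff_taylorSeries, PowerSeries.coeff_C, iteratedDeriv_const]
  split_ifs with h <;> simp [h]

theorem taylorSeries_id : taylorSeries (fun z => z) = PowerSeries.X := by
  ext n
  rw [coeff_taylorSeries, PowerSeries.coeff_X, iteratedDeriv_fun_id_zero]
  split_ifs with h <;> simp [h]

theorem taylorSeries_add {h k : ℂ → ℂ} (hh : AnalyticAt ℂ h 0) (hk : AnalyticAt ℂ k 0) :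
    taylorSeries (fun z => h z + k z) = taylorSeries h + taylorSeries k := by
  ext n
  rw [map_add, coeff_taylorSeries, coeff_taylorSeries, coeff_taylorSeries, ← mul_add,
    ← iteratedDeriv_add hh.contDiffAt hk.contDiffAt]
  rfl

theorem taylorSeries_mul {h k : ℂ → ℂ} (hh : AnalyticAt ℂ h 0) (hk : AnalyticAt ℂ k 0) :
    taylorSeries (fun z => h z * k z) = taylorSeries h * taylorSeries k := by
  ext n
  rw [PowerSeries.coeff_mul, coeff_taylorSeries,
    iteratedDeriv_fun_mul hh.contDiffAt hk.contDiffAt,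
    Finset.Nat.sum_antidiagonal_eq_sum_range_succ_mk, Finset.mul_sum]
  refine Finset.sum_congr rfl fun i hi => ?_
  rw [coeff_taylorSeries, coeff_taylorSeries,
    Nat.cast_choose ℂ (Nat.lt_succ_iff.1 (Finset.mem_range.1 hi))]
  have h1 := Nat.cast_ne_zero (R := ℂ).2 (Nat.factorial_ne_zero n)
  have h2 := Nat.cast_ne_zero (R := ℂ).2 (Nat.factorial_ne_zero i)
  have h3 := Nat.cast_ne_zero (R := ℂ).2 (Nat.factorial_ne_zero (n - i))
  field_simp

theorem derivative_taylorSeries (h : ℂ → ℂ) :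
    PowerSeries.derivative ℂ (taylorSeries h) = taylorSeries (deriv h) := by
  ext n
  rw [PowerSeries.coeff_derivative, coeff_taylorSeries, coeff_taylorSeries, iteratedDeriv_succ',
    Nat.factorial_succ]
  have h1 := Nat.cast_ne_zero (R := ℂ).2 (Nat.factorial_ne_zero n)
  have h2 : (n : ℂ) + 1 ≠ 0 := by exact_mod_cast n.succ_ne_zero
  push_cast
  field_simp

theorem taylorSeries_polynomial_eval {h : ℂ → ℂ} (hh : AnalyticAt ℂ h 0) (P : Polynomial ℂ) :
    AnalyticAt ℂ (fun z => P.eval (h z)) 0 ∧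
      taylorSeries (fun z => P.eval (h z)) = Polynomial.aeval (taylorSeries h) P := by
  induction P using Polynomial.induction_on' with
  | add p q hp hq =>
    simp only [Polynomial.eval_add, map_add]
    exact ⟨hp.1.add hq.1, by rw [taylorSeries_add hp.1 hq.1, hp.2, hq.2]⟩
  | monomial n a =>
    have hpow : AnalyticAt ℂ (fun z => h z ^ n) 0 ∧
        taylorSeries (fun z => h z ^ n) = taylorSeries h ^ n := by
      induction n with
      | zero => simpa using ⟨analyticAt_const, taylorSeries_const 1⟩
      | succ n ih =>
        simp only [pow_succ]
        exact ⟨ih.1.mul hh, by rw [taylorSeries_mul ih.1 hh, ih.2]⟩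
    simp only [Polynomial.eval_monomial, Polynomial.aeval_monomial]
    exact ⟨analyticAt_const.mul hpow.1, by
      rw [taylorSeries_mul analyticAt_const hpow.1, hpow.2, taylorSeries_const]; rfl⟩

theorem hasSum_coeff_taylorSeries {h : ℂ → ℂ} {r : ℝ}
    (hh : DifferentiableOn ℂ h (Metric.ball 0 r)) {z : ℂ} (hz : z ∈ Metric.ball (0 : ℂ) r) :
    HasSum (fun n => PowerSeries.coeff n (taylorSeries h) * z ^ n) (h z) := by
  have e : (fun n => PowerSeries.coeff n (taylorSeries h) * z ^ n)
      = fun n => (n.factorial : ℂ)⁻¹ • (z - 0) ^ n • iteratedDeriv n h 0 := by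
    funext n
    rw [coeff_taylorSeries, sub_zero, smul_eq_mul, smul_eq_mul]
    ring
  rw [e]
  exact Complex.hasSum_taylorSeries_on_ball hh hz

theorem le_cvRadius_of_summable {f : PowerSeries ℂ} {r : ℝ} (hr : 0 ≤ r)
    (hf : Summable fun n => PowerSeries.coeff n f * (r : ℂ) ^ n) :
    ENNReal.ofReal r ≤ cvRadius f := by
  refine FormalMultilinearSeries.le_radius_of_tendsto (l := 0) _ ?_
  have := hf.tendsto_atTop_zero.norm
  simpa [FormalMultilinearSeries.ofScalars_norm, Real.coe_toNNReal r hr, abs_of_nonneg hr] using this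

/-! ### Analytic branches on large discs -/

open Filter Topology in
/-- Analytic branches `φ` of the algebraic functions `Q(φ(z)) = (1 - z) Q(u)` exist on arbitrarily
large discs if `u` is close enough to a simple root `β` of `Q`. -/
theorem exists_branch {Q : Polynomial ℂ} {β : ℂ} (hβ : Q.eval β = 0)
    (hβ' : Q.derivative.eval β ≠ 0) {r ε : ℝ} (hε : 0 < ε) :
    ∀ᶠ u in 𝓝 β, ∃ φ : ℂ → ℂ, DifferentiableOn ℂ φ (Metric.ball 0 r) ∧ φ 0 = u ∧ φ 1 = β ∧
      ∀ z ∈ Metric.ball (0 : ℂ) r, Q.eval (φ z) = (1 - z) * Q.eval u ∧ ‖φ z - β‖ < ε := by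
  have hQ : AnalyticAt ℂ (fun z => Q.eval z) β := by
    simpa using AnalyticAt.aeval_polynomial (analyticAt_id (𝕜 := ℂ) (z := β)) Q
  have hd : deriv (fun z => Q.eval z) β ≠ 0 := by rwa [Polynomial.deriv]
  -- The branch will be `φ(z) = G((1 - z) Q(u))`, with `G` the local inverse of `Q` sending `0` to
  -- `β`.
  set G := hQ.hasStrictDerivAt.localInverse _ _ _ hd with hG
  have hGa := hQ.analyticAt_localInverse hd
  have hGβ : G (Q.eval β) = β := HasStrictFDerivAt.localInverse_apply_image ..
  have h1 : ∀ᶠ w in 𝓝 (Q.eval β), Q.eval (G w) = w :=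
    hQ.hasStrictDerivAt.eventually_right_inverse hd
  have h2 : ∀ᶠ w in 𝓝 (Q.eval β), ‖G w - β‖ < ε := by
    have := hGa.continuousAt
    rw [ContinuousAt, ← hG, hGβ] at this
    simpa [dist_eq_norm] using this.eventually (Metric.ball_mem_nhds β hε)
  have h3 : ∀ᶠ u in 𝓝 β, G (Q.eval u) = u :=
    hQ.hasStrictDerivAt.eventually_left_inverse hd
  have h4 : ∀ᶠ w in 𝓝 (Q.eval β), DifferentiableAt ℂ G w :=
    hGa.eventually_analyticAt.mono fun w hw => hw.differentiableAt
  rw [hβ] at h1 h2 h4 hGβ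
  obtain ⟨ρ, hρ, hball⟩ := Metric.eventually_nhds_iff_ball.1 (h1.and (h2.and h4))
  -- As `Q(u) → Q(β) = 0`, the whole disc of radius `r` is sent into the domain of `G`.
  have h5 : ∀ᶠ u in 𝓝 β, ‖Q.eval u‖ * (1 + r) < ρ := by
    have hc : ContinuousAt (fun u => ‖Q.eval u‖ * (1 + r)) β := by fun_prop
    refine hc.eventually (gt_mem_nhds ?_)
    simpa [hβ] using hρ
  filter_upwards [h3, h5] with u hu3 hu5
  have hmem : ∀ z ∈ Metric.ball (0 : ℂ) r, (1 - z) * Q.eval u ∈ Metric.ball (0 : ℂ) ρ := by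
    intro z hz
    rw [mem_ball_zero_iff] at hz ⊢
    rw [norm_mul, mul_comm]
    refine (mul_le_mul_of_nonneg_left ?_ (norm_nonneg _)).trans_lt hu5
    calc ‖1 - z‖ ≤ ‖(1 : ℂ)‖ + ‖z‖ := norm_sub_le _ _
      _ ≤ 1 + r := by rw [norm_one]; linarith
  refine ⟨fun z => G ((1 - z) * Q.eval u), fun z hz => ?_, by simpa using hu3, by simpa using hGβ,
    fun z hz => ⟨(hball _ (hmem z hz)).1, (hball _ (hmem z hz)).2.1⟩⟩
  have := (hball _ (hmem z hz)).2.2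
  exact (DifferentiableAt.comp z (g := G) this (by fun_prop)).differentiableWithinAt

/-! ### The G-function conditions -/

theorem isGFunction_of_denominators {F : PowerSeries ℂ} {M : ℝ} {D : ℕ} (hD : D ≠ 0)
    (hM : ∀ n, ‖PowerSeries.coeff n F‖ ≤ M)
    (hK : ∀ n, PowerSeries.coeff n F ∈ IntermediateField.adjoin ℚ {Complex.I})
    (hden : ∀ m n, m ≤ n →
      IsIntegral ℤ (((D ^ n * Nat.lcmUpto n : ℕ) : ℂ) * PowerSeries.coeff m F))
    (hode : ∃ (r : ℕ) (p : ℕ → Polynomial ℂ),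
      (∀ j k : ℕ, IsAlgebraic ℚ ((p j).coeff k)) ∧ p r ≠ 0 ∧
      ∑ j ∈ Finset.range (r + 1),
        (p j : PowerSeries ℂ) * (PowerSeries.derivative ℂ)^[j] F = 0) :
    IsGFunction F := by
  refine ⟨fun n => isAlgebraic_of_mem_adjoin_I (hK n), ?_, hode⟩
  set E : ℝ := D * Real.exp (Real.log 4 + 4) with hE
  have hE0 : 0 ≤ E := by positivity
  have hC1 : 1 ≤ |M| + 1 + E := by linarith [abs_nonneg M]
  have hC0 : (0 : ℝ) < |M| + 1 + E := by linarith
  refine ⟨|M| + 1 + E, hC0, fun n β hβ => ?_,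
    fun n => ((D ^ n * Nat.lcmUpto n : ℕ) : ℤ), fun n => ⟨?_, ?_, fun m hm => ?_⟩⟩
  · rw [norm_eq_of_isConjRoot_of_mem_adjoin_I (hK n) hβ]
    calc _ ≤ M := hM n
      _ ≤ |M| + 1 + E := by linarith [le_abs_self M]
      _ ≤ _ := le_self_pow₀ hC1 n.succ_ne_zero
  · exact Int.natCast_ne_zero.2 (mul_ne_zero (pow_ne_zero n hD) (Nat.lcmUpto_ne_zero n))
  · rw [Int.cast_natCast, Nat.abs_cast, Nat.cast_mul, Nat.cast_pow]
    calc (D : ℝ) ^ n * (Nat.lcmUpto n : ℝ)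
        ≤ (D : ℝ) ^ n * Real.exp (Real.log 4 + 4) ^ n := by
          gcongr
          exact natCast_lcmUpto_le n
      _ = E ^ n := (mul_pow _ _ _).symm
      _ ≤ (|M| + 1 + E) ^ n := pow_le_pow_left₀ hE0 (by linarith [abs_nonneg M]) n
      _ ≤ (|M| + 1 + E) ^ (n + 1) := pow_le_pow_right₀ hC1 n.le_succ
  · rw [Int.cast_natCast]
    exact hden m n hm

-- Recentring at `u` puts `Φ - u` in the Eisenstein setting, with linear coefficient `Q'(u) ≠ 0`.
open PowerSeries in
theorem exists_denominators_of_algebraic {K : IntermediateField ℚ ℂ}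
    (hK : ∀ x ∈ K, IsAlgebraic ℚ x) {Q : Polynomial K} {u : ℂ} (hu : u ∈ K) (hu0 : u ≠ 0)
    (hQu : Polynomial.aeval u (Polynomial.derivative Q) ≠ 0)
    {Φ F : PowerSeries ℂ} {N : ℕ} (hF0 : constantCoeff F = 0) (hΦ0 : constantCoeff Φ = u)
    (hΦ : Polynomial.aeval Φ (Q.map (algebraMap K ℂ)) = (1 - X) * C (Polynomial.aeval u Q))
    (hF : derivative ℂ F * (C u⁻¹ * Φ * (1 + C (u - 1) * X))
      = C (N : ℂ) * derivative ℂ (C u⁻¹ * Φ * (1 + C (u - 1) * X))) :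
    ∃ D : ℕ, D ≠ 0 ∧ ∀ m n, m ≤ n →
      ((D ^ n * Nat.lcmUpto n : ℕ) : ℂ) * coeff m F ∈ integersIn K := by
  set P := Polynomial.taylor u (Q.map (algebraMap K ℂ)) with hP
  have hPK : ∀ k, P.coeff k ∈ K := fun k => by
    have : P = (Polynomial.taylor (⟨u, hu⟩ : K) Q).map (algebraMap K ℂ) := by
      rw [hP, Polynomial.map_taylor]; rfl
    rw [this, Polynomial.coeff_map]
    exact Subtype.prop _
  have hP0 : P.coeff 0 = Polynomial.aeval u Q := by
    rw [hP, Polynomial.taylor_coeff_zero, Polynomial.eval_map_algebraMap]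
  have hP1 : P.coeff 1 ≠ 0 := by
    rwa [hP, Polynomial.taylor_coeff_one, Polynomial.derivative_map,
      Polynomial.eval_map_algebraMap]
  have hY : Polynomial.aeval (Φ - C u) P = (1 - X) * C (P.coeff 0) := by
    rw [hP0, ← hΦ, hP, Polynomial.taylor_apply, Polynomial.aeval_comp]
    congr 1
    simp
  obtain ⟨D₁, hD₁, h₁⟩ := exists_rescale_coeff_mem_integersIn hK hPK hP1 (by simp [hΦ0]) hY
  obtain ⟨D₂, hD₂, h₂⟩ := exists_natCast_mul_mem_integersIn hK (K.inv_mem hu)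
  obtain ⟨D₃, hD₃, h₃⟩ := exists_natCast_mul_mem_integersIn hK (K.sub_mem hu K.one_mem)
  set A := integersIn K
  -- The factors serve `Φ - u`, `u⁻¹` and `u - 1` respectively.
  set D := D₁ * D₂ * D₃ with hDdef
  have hD : D ≠ 0 := mul_ne_zero (mul_ne_zero hD₁ hD₂) hD₃
  have hΓ1 : constantCoeff (C u⁻¹ * Φ * (1 + C (u - 1) * X)) = 1 := by
    simp [hΦ0, hu0]
  have hcΦ : ∀ n, coeff n (rescale (D : ℂ) (C u⁻¹ * Φ)) ∈ A := fun n => by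
    rw [coeff_rescale, coeff_C_mul]
    rcases n with _ | n
    · rw [coeff_zero_eq_constantCoeff_apply, hΦ0, pow_zero, one_mul, inv_mul_cancel₀ hu0]
      exact one_mem A
    · have h := h₁ (n + 1)
      rw [coeff_rescale, map_sub, coeff_C, if_neg n.succ_ne_zero, sub_zero] at h
      have e : (D : ℂ) ^ (n + 1) * (u⁻¹ * coeff (n + 1) Φ)
          = (D₂ : ℂ) ^ n * (D₃ : ℂ) ^ (n + 1) * ((D₂ : ℂ) * u⁻¹)
            * ((D₁ : ℂ) ^ (n + 1) * coeff (n + 1) Φ) := by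
        rw [hDdef]; push_cast; ring
      rw [e]
      exact mul_mem (mul_mem (mul_mem (pow_mem (natCast_mem _ _) _)
        (pow_mem (natCast_mem _ _) _)) h₂) h
  have hl : ∀ n, coeff n (rescale (D : ℂ) (1 + C (u - 1) * X)) ∈ A := fun n => by
    rw [map_add, map_mul, rescale_C, rescale_X, map_one, map_add, ← mul_assoc, ← map_mul,
      coeff_C_mul, coeff_one, coeff_X]
    have e : (u - 1) * (D : ℂ) = (D₁ : ℂ) * D₂ * (D₃ * (u - 1)) := by
      rw [hDdef]; push_cast; ring
    rw [e]
    refine add_mem ?_ (mul_mem (mul_mem (mul_mem (natCast_mem _ _) (natCast_mem _ _)) h₃) ?_)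
    all_goals split_ifs
    exacts [one_mem _, zero_mem _, one_mem _, zero_mem _]
  have hΓ : ∀ n, coeff n (rescale (D : ℂ) (C u⁻¹ * Φ * (1 + C (u - 1) * X))) ∈ A := fun n => by
    rw [map_mul, coeff_mul]
    exact sum_mem fun p _ => mul_mem (hcΦ _) (hl _)
  exact ⟨D, hD, exists_denominators_of_logarithmic hF0 hΓ1 hF hΓ⟩

open PowerSeries in
/-- `N log (u⁻¹ φ (1 + (u - 1) z))` is a G-function when `φ` is the branch of `Q(φ) = (1 - z) Q(u)`
with `φ(0) = u`. -/
theorem isGFunction_of_logarithmic {Q : Polynomial (IntermediateField.adjoin ℚ {Complex.I})}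
    (hQ : Q.Monic) {u : ℂ} (hu : u ∈ IntermediateField.adjoin ℚ {Complex.I}) (hu0 : u ≠ 0)
    (hQu : Polynomial.aeval u (Polynomial.derivative Q) ≠ 0)
    {Φ F : PowerSeries ℂ} {N : ℕ} {M : ℝ} (hM : ∀ n, ‖coeff n F‖ ≤ M)
    (hF0 : constantCoeff F = 0) (hΦ0 : constantCoeff Φ = u)
    (hΦ : Polynomial.aeval Φ (Q.map (algebraMap _ ℂ)) = (1 - X) * C (Polynomial.aeval u Q))
    (hF : derivative ℂ F * (C u⁻¹ * Φ * (1 + C (u - 1) * X))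
      = C (N : ℂ) * derivative ℂ (C u⁻¹ * Φ * (1 + C (u - 1) * X))) :
    IsGFunction F ∧ ∀ n, coeff n F ∈ IntermediateField.adjoin ℚ {Complex.I} := by
  have hK : ∀ x ∈ IntermediateField.adjoin ℚ {Complex.I}, IsAlgebraic ℚ x :=
    fun x hx => isAlgebraic_of_mem_adjoin_I hx
  obtain ⟨D, hD, hden⟩ := exists_denominators_of_algebraic hK hu hu0 hQu hF0 hΦ0 hΦ hF
  -- `integersIn` also records membership in the field, so dividing out the denominator leaves the
  -- coefficient in `ℚ(i)`.
  have hFK : ∀ n, coeff n F ∈ IntermediateField.adjoin ℚ {Complex.I} := fun n => by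
    have h := mul_mem (inv_mem (natCast_mem (IntermediateField.adjoin ℚ {Complex.I})
      (D ^ n * Nat.lcmUpto n))) (hden n n le_rfl).2
    rwa [← mul_assoc, inv_mul_cancel₀, one_mul] at h
    exact Nat.cast_ne_zero.2 (mul_ne_zero (pow_ne_zero n hD) (Nat.lcmUpto_ne_zero n))
  exact ⟨isGFunction_of_denominators hD hM hFK (fun m n h => (hden m n h).1)
    (exists_differential_equation_of_logarithmic hK hQ hu hu0 hQu hΦ0 hΦ hF), hFK⟩

/-! ### Choice of parameters and conclusion -/

open Topology in
theorem exists_mem_adjoin_I_of_eventually {β : ℂ} {p : ℂ → Prop} (hp : ∀ᶠ u in 𝓝 β, p u) :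
    ∃ u ∈ IntermediateField.adjoin ℚ {Complex.I}, p u := by
  obtain ⟨δ, hδ, h⟩ := Metric.eventually_nhds_iff.1 hp
  obtain ⟨x, hx1, hx2⟩ := exists_rat_btwn (show β.re < β.re + δ / 2 by linarith)
  obtain ⟨y, hy1, hy2⟩ := exists_rat_btwn (show β.im < β.im + δ / 2 by linarith)
  set K := IntermediateField.adjoin ℚ {Complex.I}
  have hI : Complex.I ∈ K := IntermediateField.mem_adjoin_simple_self ℚ _
  refine ⟨(x : ℂ) + y * Complex.I,
    K.add_mem (K.algebraMap_mem x) (K.mul_mem (K.algebraMap_mem y) hI), h ?_⟩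
  rw [dist_eq_norm]
  refine (Complex.norm_le_abs_re_add_abs_im _).trans_lt ?_
  have h1 : |((x : ℂ) + y * Complex.I - β).re| < δ / 2 := by
    simp only [Complex.sub_re, Complex.add_re, Complex.ratCast_re, Complex.mul_re, Complex.I_re,
      Complex.ratCast_im, Complex.I_im]
    rw [abs_lt]; constructor <;> linarith
  have h2 : |((x : ℂ) + y * Complex.I - β).im| < δ / 2 := by
    simp only [Complex.sub_im, Complex.add_im, Complex.ratCast_re, Complex.mul_im, Complex.I_re,
      Complex.ratCast_im, Complex.I_im]
    rw [abs_lt]; constructor <;> linarith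
  linarith

theorem isAlgebraic_exp_div {ξ : ℂ} (h : IsAlgebraic ℚ (Complex.exp ξ)) {N : ℕ} (hN : N ≠ 0) :
    IsAlgebraic ℚ (Complex.exp (ξ / N)) := by
  refine IsAlgebraic.of_pow (Nat.pos_of_ne_zero hN) ?_
  rwa [← Complex.exp_nat_mul, mul_div_cancel₀ _ (Nat.cast_ne_zero.2 hN)]

-- Since `ξ / N → 0`, it eventually lies in the strip where the principal logarithm inverts `exp`.
open Filter Topology in
theorem exists_nat_exp_div_near_one (ξ : ℂ) {ε : ℝ} (hε : 0 < ε) :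
    ∃ N : ℕ, N ≠ 0 ∧ ‖Complex.exp (ξ / N) - 1‖ < ε ∧ Complex.log (Complex.exp (ξ / N)) = ξ / N := by
  have h0 : Tendsto (fun N : ℕ => ξ / N) atTop (𝓝 0) := tendsto_const_div_atTop_nhds_zero_nat ξ
  have h1 : Tendsto (fun N : ℕ => Complex.exp (ξ / N)) atTop (𝓝 1) := by
    simpa [Function.comp_def] using (Complex.continuous_exp.tendsto 0).comp h0
  have h2 : ∀ᶠ N : ℕ in atTop, ‖Complex.exp (ξ / N) - 1‖ < ε := by
    simpa [dist_eq_norm] using h1.eventually (Metric.ball_mem_nhds 1 hε)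
  have h3 : ∀ᶠ N : ℕ in atTop, ‖ξ / N‖ < Real.pi := by
    simpa [dist_eq_norm] using h0.eventually (Metric.ball_mem_nhds 0 Real.pi_pos)
  obtain ⟨N, hN0, hN1, hN2⟩ := ((eventually_ne_atTop 0).and (h2.and h3)).exists
  have := abs_lt.1 ((Complex.abs_im_le_norm _).trans_lt hN2)
  exact ⟨N, hN0, hN1, Complex.log_exp this.1 this.2.le⟩

open Filter Topology in
/-- Every complex logarithm of a nonzero algebraic number `α` (that is, every `ξ` with
`exp ξ = α`, the possible values at `α` of the determinations of the logarithm) lies in the set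
`GValues ℚ(i)`. -/
theorem mainTheorem6 (α : ℂ) (hα : IsAlgebraic ℚ α) (hα0 : α ≠ 0)
    (ξ : ℂ) (hξ : Complex.exp ξ = α) :
    ξ ∈ GValues (IntermediateField.adjoin ℚ {Complex.I}) := by
  intro R hR
  have hr : 0 < R + 2 := by linarith
  -- This size gives `|(u - 1) z| ≤ 1/8` on the disc and `|u| ≥ 7/8`, which keeps `g` within
  -- distance `1` of `1`.
  set ε : ℝ := 1 / (16 * (R + 2)) with hε
  have hε0 : 0 < ε := by positivity
  have hεR : ε * (R + 2) = 1 / 16 := by rw [hε]; field_simp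
  have hε16 : ε ≤ 1 / 16 := by nlinarith
  obtain ⟨N, hN, hβ1, hlog⟩ := exists_nat_exp_div_near_one ξ hε0
  have hβalg : IsAlgebraic ℚ (Complex.exp (ξ / N)) := isAlgebraic_exp_div (hξ ▸ hα) hN
  set β := Complex.exp (ξ / N)
  set K := IntermediateField.adjoin ℚ {Complex.I} with hK
  set Q : Polynomial K := (minpoly ℚ β).map (algebraMap ℚ K) with hQ
  have hQm : Q.Monic := (minpoly.monic hβalg.isIntegral).map _
  have hQC : Q.map (algebraMap K ℂ) = (minpoly ℚ β).map (algebraMap ℚ ℂ) := by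
    rw [hQ, Polynomial.map_map, ← IsScalarTower.algebraMap_eq]
  set q := Q.map (algebraMap K ℂ) with hq
  have hqβ : q.eval β = 0 := by
    rw [hQC, Polynomial.eval_map_algebraMap, minpoly.aeval]
  have hqβ' : q.derivative.eval β ≠ 0 := by
    rw [hQC, Polynomial.derivative_map, Polynomial.eval_map_algebraMap]
    exact (minpoly.irreducible hβalg.isIntegral).separable.aeval_derivative_ne_zero
      (minpoly.aeval ℚ β)
  have hcont : ∀ᶠ u in 𝓝 β, q.derivative.eval u ≠ 0 :=
    (q.derivative.continuous.continuousAt).eventually_ne hqβ'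
  have hnear : ∀ᶠ u in 𝓝 β, ‖u - β‖ < ε := by
    filter_upwards [Metric.ball_mem_nhds β hε0] with u hu using mem_ball_iff_norm.1 hu
  obtain ⟨u, huK, ⟨φ, hφd, hφ0, hφ1, hφ⟩, hqu, huβ⟩ := exists_mem_adjoin_I_of_eventually
    ((exists_branch hqβ hqβ' hε0).and (hcont.and hnear))
  have hu1 : ‖u - 1‖ < 2 * ε := by
    calc ‖u - 1‖ = ‖(u - β) + (β - 1)‖ := by ring_nf
      _ ≤ ‖u - β‖ + ‖β - 1‖ := norm_add_le _ _
      _ < 2 * ε := by linarith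
  have hunorm : 7 / 8 ≤ ‖u‖ := by
    have h1 : ‖(1 : ℂ)‖ ≤ ‖u‖ + ‖u - 1‖ := by
      calc ‖(1 : ℂ)‖ = ‖u - (u - 1)‖ := by ring_nf
        _ ≤ _ := norm_sub_le _ _
    rw [norm_one] at h1
    linarith
  have hu0 : u ≠ 0 := norm_pos_iff.1 (by linarith)
  -- The last factor is `1` at `0` and `u` at `1`: it undoes the normalisation `u⁻¹` at the point
  -- `1` only.
  set g : ℂ → ℂ := fun z => u⁻¹ * φ z * (1 + (u - 1) * z) with hg
  have hg1 : ∀ z ∈ Metric.ball (0 : ℂ) (R + 2), ‖g z - 1‖ < 1 := by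
    intro z hz
    have ha : ‖u⁻¹ * φ z - 1‖ ≤ 1 / 3 := by
      have e : u⁻¹ * φ z - 1 = u⁻¹ * (φ z - u) := by field_simp
      have h1 : ‖φ z - u‖ ≤ 2 * ε := by
        calc ‖φ z - u‖ = ‖(φ z - β) - (u - β)‖ := by ring_nf
          _ ≤ ‖φ z - β‖ + ‖u - β‖ := norm_sub_le _ _
          _ ≤ 2 * ε := by linarith [(hφ z hz).2]
      rw [e, norm_mul, norm_inv, inv_mul_le_iff₀ (by linarith)]
      linarith
    have hb : ‖(u - 1) * z‖ ≤ 1 / 8 := by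
      rw [mem_ball_zero_iff] at hz
      rw [norm_mul]
      calc ‖u - 1‖ * ‖z‖ ≤ (2 * ε) * (R + 2) := by gcongr
        _ = 1 / 8 := by linarith
    have e : g z - 1 = (u⁻¹ * φ z - 1) + (u⁻¹ * φ z - 1) * ((u - 1) * z) + (u - 1) * z := by
      rw [hg]; ring
    rw [e]
    calc _ ≤ ‖u⁻¹ * φ z - 1‖ + ‖u⁻¹ * φ z - 1‖ * ‖(u - 1) * z‖ + ‖(u - 1) * z‖ := by
            refine (norm_add_le _ _).trans (add_le_add_left ((norm_add_le _ _).trans_eq ?_) _)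
            rw [norm_mul]
      _ ≤ 1 / 3 + 1 / 3 * (1 / 8) + 1 / 8 := by gcongr
      _ < 1 := by norm_num
  have hgs : ∀ z ∈ Metric.ball (0 : ℂ) (R + 2), g z ∈ Complex.slitPlane := fun z hz => by
    simpa using Complex.mem_slitPlane_of_norm_lt_one (hg1 z hz)
  have hgd : DifferentiableOn ℂ g (Metric.ball 0 (R + 2)) := by
    rw [hg]; fun_prop
  set f : ℂ → ℂ := fun z => N * Complex.log (g z) with hf
  have hfd : DifferentiableOn ℂ f (Metric.ball 0 (R + 2)) :=
    (hgd.clog hgs).const_mul _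
  have hnhds : ∀ᶠ z in 𝓝 (0 : ℂ), z ∈ Metric.ball (0 : ℂ) (R + 2) := Metric.ball_mem_nhds 0 hr
  have hφa : AnalyticAt ℂ φ 0 := hφd.analyticAt hnhds
  have hga : AnalyticAt ℂ g 0 := hgd.analyticAt hnhds
  have hfa : AnalyticAt ℂ f 0 := hfd.analyticAt hnhds
  have hφT : Polynomial.aeval (taylorSeries φ) q
      = (1 - PowerSeries.X) * PowerSeries.C (Polynomial.aeval u Q) := by
    rw [← (taylorSeries_polynomial_eval hφa q).2,
      taylorSeries_congr (k := fun z => (1 + (-1) * z) * q.eval u)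
        (hnhds.mono fun z hz => by rw [(hφ z hz).1]; ring),
      taylorSeries_mul (by fun_prop) (by fun_prop), taylorSeries_add (by fun_prop) (by fun_prop),
      taylorSeries_mul (by fun_prop) (by fun_prop), taylorSeries_const, taylorSeries_const,
      taylorSeries_const, taylorSeries_id, hq, Polynomial.eval_map_algebraMap]
    simp [sub_eq_add_neg]
  have hgT : taylorSeries g = PowerSeries.C u⁻¹ * taylorSeries φ
      * (1 + PowerSeries.C (u - 1) * PowerSeries.X) := by
    rw [hg, taylorSeries_mul (by fun_prop) (by fun_prop),
      taylorSeries_mul (by fun_prop) (by fun_prop), taylorSeries_add (by fun_prop) (by fun_prop),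
      taylorSeries_mul (by fun_prop) (by fun_prop), taylorSeries_const, taylorSeries_const,
      taylorSeries_const, taylorSeries_id, map_one]
  have hfT : PowerSeries.derivative ℂ (taylorSeries f) * taylorSeries g
      = PowerSeries.C (N : ℂ) * PowerSeries.derivative ℂ (taylorSeries g) := by
    rw [derivative_taylorSeries, derivative_taylorSeries, ← taylorSeries_mul hfa.deriv hga,
      ← taylorSeries_const, ← taylorSeries_mul analyticAt_const hga.deriv]
    refine taylorSeries_congr (hnhds.mono fun z hz => ?_)
    have hgz : DifferentiableAt ℂ g z := hgd.differentiableAt (Metric.isOpen_ball.mem_nhds hz)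
    have hne : g z ≠ 0 := Complex.slitPlane_ne_zero (hgs z hz)
    have : deriv f z = N * (deriv g z / g z) :=
      ((hgz.hasDerivAt.clog (hgs z hz)).const_mul _).deriv
    simp only [this]
    field_simp
  have hg0 : g 0 = 1 := by simp [hg, hφ0, hu0]
  have hf1 : f 1 = ξ := by
    have : g 1 = β := by simp [hg, hφ1]; field_simp
    rw [hf]
    simp only [this, hlog]
    rw [mul_div_cancel₀ _ (Nat.cast_ne_zero.2 hN)]
  have hsum : HasSum (fun n => PowerSeries.coeff n (taylorSeries f)) ξ := by
    have := hasSum_coeff_taylorSeries hfd (z := 1) (by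
      rw [mem_ball_zero_iff, norm_one]; linarith)
    simpa [hf1] using this
  -- Convergence at `1` already bounds the coefficients.
  obtain ⟨M, hM⟩ := hsum.summable.tendsto_atTop_zero.norm.bddAbove_range
  have hG := isGFunction_of_logarithmic hQm huK hu0
    (by rwa [hq, Polynomial.derivative_map, Polynomial.eval_map_algebraMap] at hqu)
    (F := taylorSeries f) (M := M) (fun n => hM ⟨n, rfl⟩)
    (by rw [constantCoeff_taylorSeries, hf]; simp [hg0])
    (by rw [constantCoeff_taylorSeries, hφ0]) hφT (by rw [← hgT]; exact hfT)
  refine ⟨taylorSeries f, hG.1, hG.2, ?_, hsum⟩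
  refine lt_of_lt_of_le ?_ (le_cvRadius_of_summable (r := R + 1) (by linarith)
    (hasSum_coeff_taylorSeries hfd (z := ((R + 1 : ℝ) : ℂ)) ?_).summable)
  · exact (ENNReal.ofReal_lt_ofReal_iff (by linarith)).2 (by linarith)
  · rw [mem_ball_zero_iff, Complex.norm_real, Real.norm_of_nonneg (by linarith)]
    linarith
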